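/- Let $K$ be $\mathbb{R}$, $\mathbb{C}$ or the quaternions $\mathbb{H}$, let $d\ge 1$, and equip $K^d$ with $\langle x,y\rangle = x^*y=\sum_k \overline{x_k}\,y_k$. A Borel probability measure $\mu$ on $K^d$ is called isotropic if $\mathbb{E}_{x\sim\mu}\,xx^*$ exists and equals $\frac1d I_d$. Put $$\beta=\sqrt{\frac{1}{d+2(\dim_{\mathbb{R}}K)^{-1}}},\qquad M=d+\frac{d^2-d}{2}\dim_{\mathbb{R}}K .$$ A maximal simplex is a set of $M$ distinct lines $x_1K,\dots,x_MK$ in $K^d$ (scalars act on the right), with $x_i$ of unit length, such that $|\langle x_i,x_j\rangle|$ has the same value for all $i\ne j$. Theorem. Let $q\in[1,2]$. For every isotropic measure $\mu$ on $K^d$ the $q$-th moment is finite and $$\mathbb{E}_{x,y\sim\mu}|\langle x,y\rangle|^q=\iint|\langle x,y\rangle|^q\,d\mu(x)\,d\mu(y)\le \beta^q+\frac{1-\beta^q}{M}.$$ If $q\in[1,2)$ and equality holds, then a maximal simplex exists and $\mu$ is the uniform distribution over a maximal simplex, in the following sense: there is a maximal simplex $x_1K,\dots,x_MK$, with unit vectors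 $x_i$, such that $\mu$ is concentrated on the unit vectors lying on these lines and $\mu(\{x_ic : c\in K,\ |c|=1\})=\frac1M$ for each $i$. -/

import Mathlib

open MeasureTheory
open scoped Quaternion

/-- The Borel σ-algebra on the quaternions. -/
noncomputable instance quaternionMeasurableSpace : MeasurableSpace ℍ[ℝ] := borel ℍ[ℝ]

instance quaternionBorelSpace : BorelSpace ℍ[ℝ] := ⟨rfl⟩

noncomputable section

/-! Throughout, `K` is instantiated with `ℝ`, `ℂ` or `ℍ[ℝ]`, and `K ^ d` is `Fin d → K`,
with its product (equivalently, Borel) σ-algebra. -/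

/-- The standard Hermitian product `⟨x, y⟩ = x* y` on `K ^ d`. -/
def hermProd {K : Type} [NormedDivisionRing K] [StarRing K] {d : ℕ} (x y : Fin d → K) : K :=
  ∑ k, star (x k) * y k

/-- A Borel probability measure `μ` on `K ^ d` with `𝔼 x x* = (1 / d) I`; the expectation of the
matrix `x x*` is taken entrywise, and its existence is part of the definition. -/
structure IsIsotropicMeasure {K : Type} [NormedDivisionRing K] [StarRing K] [NormedAlgebra ℝ K]
    [MeasurableSpace K] {d : ℕ} (μ : Measure (Fin d → K)) : Prop where
  isProbabilityMeasure : IsProbabilityMeasure μ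
  integrable : ∀ i j, Integrable (fun x : Fin d → K => Matrix.vecMulVec x (star x) i j) μ
  integral_eq : ∀ i j, ∫ x : Fin d → K, Matrix.vecMulVec x (star x) i j ∂μ =
    ((1 / (d : ℝ)) • (1 : Matrix (Fin d) (Fin d) K)) i j

/-- The unit-length representatives of the point of the projective space `K ℙ ^ (d - 1)`
represented by the unit vector `x`: the vectors `x c` with `c ∈ K`, `|c| = 1`.
Scalars act on the right. -/
def unitRepresentatives {K : Type} [NormedDivisionRing K] {d : ℕ} (x : Fin d → K) :
    Set (Fin d → K) :=
  {y | ∃ c : K, ‖c‖ = 1 ∧ ∀ k, y k = x k * c}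

/-- A regular simplex of `N` points in `K ℙ ^ (d - 1)`, given by unit-length representatives
`x 0, …, x (N - 1)`: the lines `x i K` are pairwise distinct and `|⟨x i, x j⟩|` takes the same
value for all `i ≠ j`. -/
structure IsRegularSimplex {K : Type} [NormedDivisionRing K] [StarRing K] {d N : ℕ}
    (x : Fin N → Fin d → K) : Prop where
  unit : ∀ i, hermProd (x i) (x i) = 1
  distinct : ∀ i j, i ≠ j → ∀ c : K, ¬ ∀ k, x j k = x i k * c
  equiangular : ∃ α : ℝ, ∀ i j, i ≠ j → ‖hermProd (x i) (x j)‖ = α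

/-- The number `d + (d² - d) / 2 * dim_ℝ K`; the division is exact. -/
def maxSimplexSize (K : Type) [NormedDivisionRing K] [NormedAlgebra ℝ K] (d : ℕ) : ℕ :=
  d + (d ^ 2 - d) / 2 * Module.finrank ℝ K

/-- The number `√(1 / (d + 2 / dim_ℝ K))`. -/
def simplexBeta (K : Type) [NormedDivisionRing K] [NormedAlgebra ℝ K] (d : ℕ) : ℝ :=
  √(1 / ((d : ℝ) + 2 * (Module.finrank ℝ K : ℝ)⁻¹))

/-- A maximal simplex: a regular simplex with `d + (d² - d) / 2 * dim_ℝ K` points. -/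
def IsMaximalSimplex {K : Type} [NormedDivisionRing K] [StarRing K] [NormedAlgebra ℝ K] {d : ℕ}
    (x : Fin (maxSimplexSize K d) → Fin d → K) : Prop :=
  IsRegularSimplex x

/-- The measure `μ` on `K ^ d` is a uniform distribution over the projective points represented
by the unit vectors `x 0, …, x (N - 1)`: it is concentrated on unit-length representatives of
these points, and the representatives of each of the points have total mass `1 / N`. (How the
mass of one point is divided among its unit-length representatives is not prescribed.) -/
structure IsUniformOverPoints {K : Type} [NormedDivisionRing K] [MeasurableSpace K] {d N : ℕ}
    (μ : Measure (Fin d → K)) (x : Fin N → Fin d → K) : Prop where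
  concentrated : ∀ᵐ y ∂μ, ∃ i, y ∈ unitRepresentatives (x i)
  mass : ∀ i, μ (unitRepresentatives (x i)) = (N : ENNReal)⁻¹

/-- The function `|⟨x, y⟩| ^ q` of a pair of vectors; its integral against `μ × μ` is the
`q`-th moment of `μ`. -/
def momentKernel {K : Type} [NormedDivisionRing K] [StarRing K] {d : ℕ} (q : ℝ)
    (p : (Fin d → K) × (Fin d → K)) : ℝ :=
  ‖hermProd p.1 p.2‖ ^ q

/-- The bound `β ^ q + (1 - β ^ q) / M`. -/
def momentBound (K : Type) [NormedDivisionRing K] [NormedAlgebra ℝ K] (d : ℕ) (q : ℝ) : ℝ :=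
  simplexBeta K d ^ q + (1 - simplexBeta K d ^ q) / (maxSimplexSize K d : ℝ)

end

/-! Send `x` to `X = x x*` in the real Euclidean space `V` of Hermitian matrices, with `e` the
identity. Then `⟪X, Y⟫ = |⟨x, y⟩|²` and `⟪e, X⟫ = ‖X‖ = |x|²`, isotropy says that `X` has mean `e /
D` with `D = d`, and `dim V ≤ M`. With `p = q / 2` and `b = β²`, the task is to bound the mean of
`⟪X, Y⟫ ^ p`.

For unit vectors this is a linear programming bound. On `[0, 1]` the function `s ^ p` lies below a
quadratic with leading coefficient `-C ≤ 0` that touches it at `b` and meets it at `1`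
(`exists_moment_certificate`). The mean of `s = ⟪X, Y⟫` is `1 / D`. Its variance is at least `c = (1
- 1 / D)² / (M - 1)`, by Cauchy–Schwarz for the eigenvalues of the covariance of `X` on the
complement of `e`. A maximal simplex would give the law of `s` on `{b, 1}` for which all this is
sharp.

For vectors of other lengths the majorant is multiplied by `‖X‖ ^ p ‖Y‖ ^ p`. Bernoulli's inequality
controls the constant term and a three-term AM-GM the linear term, so `α, γ ≥ 0` is needed; the
variance bound holds with weights (`moment_le_of_certificate`).

If `q < 2`, then `α > 0`, and equality forces `‖X‖ = 1` and `s ∈ {b, 1}` almost surely. The mean of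
`⟪X ω, X⟫` then determines the mass of each atom as `1 / M` (`exists_uniform_of_ae_inner_eq`). -/

/-! ### Quadratic majorants of `s ^ p` on `[0, 1]`. -/

/-- The quadratic polynomial touching `s ^ p` at `b` and meeting it at `1` lies above it on
`[0, 1]`. -/
theorem exists_quadratic_majorant_rpow {p b : ℝ} (hp : 0 < p) (hp1 : p < 1) (hb : 0 < b)
    (hb1 : b < 1) :
    ∃ C : ℝ, 0 < C ∧ 2 * C ≤ p * (1 - p) * b ^ (p - 2) ∧
      b ^ p + p * b ^ (p - 1) * (1 - b) - C * (1 - b) ^ 2 = 1 ∧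
      ∀ s ∈ Set.Icc (0 : ℝ) 1, s ^ p ≤ b ^ p + p * b ^ (p - 1) * (s - b) - C * (s - b) ^ 2 ∧
        (s ^ p = b ^ p + p * b ^ (p - 1) * (s - b) - C * (s - b) ^ 2 → s = b ∨ s = 1) := by
  -- `C` makes the quadratic take the value `1` at `1`.
  obtain ⟨C, hC⟩ : ∃ C : ℝ, C * (1 - b) ^ 2 = b ^ p + p * b ^ (p - 1) * (1 - b) - 1 :=
    ⟨_, div_mul_cancel₀ _ (by have : 0 < 1 - b := by linarith
                              positivity)⟩
  set G : ℝ → ℝ := fun s => b ^ p + p * b ^ (p - 1) * (s - b) - C * (s - b) ^ 2 - s ^ p with hG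
  set G1 : ℝ → ℝ := fun s => p * b ^ (p - 1) - 2 * C * (s - b) - p * s ^ (p - 1) with hG1
  set G2 : ℝ → ℝ := fun s => - 2 * C + p * (1 - p) * s ^ (p - 2) with hG2
  have hd1 : ∀ s, 0 < s → HasDerivAt G (G1 s) s := by
    intro s hs
    have h1 := (Real.hasDerivAt_rpow_const (p := p) (Or.inl hs.ne'))
    have h0 := (hasDerivAt_id s).sub_const b
    have h2 := (((h0.const_mul (p * b ^ (p - 1))).const_add (b ^ p)).sub
      ((h0.pow 2).const_mul C)).sub h1
    refine h2.congr_deriv ?_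
    simp [hG1]; ring
  have hd2 : ∀ s, 0 < s → HasDerivAt G1 (G2 s) s := by
    intro s hs
    have h1 := (Real.hasDerivAt_rpow_const (p := p - 1) (Or.inl hs.ne')).const_mul p
    have h0 := ((hasDerivAt_id s).sub_const b).const_mul (2 * C)
    refine ((h0.const_sub (p * b ^ (p - 1))).sub h1).congr_deriv ?_
    rw [show p - 1 - 1 = p - 2 by ring]
    simp [hG2]; ring
  have hGc : Continuous G := by
    have : Continuous fun s : ℝ => s ^ p := Real.continuous_rpow_const hp.le
    fun_prop
  have hGb : G b = 0 := by simp [hG]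
  have hGone : G 1 = 0 := by simp [hG, hC]
  have hG1b : G1 b = 0 := by simp [hG1]
  -- Rolle twice: `G` vanishes at `b` and `1`, hence `G1` at `b` and `t`, hence `G2` at some `ξ >
  -- b`. The last zero expresses `C` through `ξ`, which gives both bounds on `C`.
  obtain ⟨t, ⟨hbt, ht1⟩, ht⟩ := exists_hasDerivAt_eq_zero hb1 hGc.continuousOn
    (hGb.trans hGone.symm) (fun x hx => hd1 x (hb.trans hx.1))
  obtain ⟨ξ, ⟨hbξ, hξt⟩, hξ⟩ := exists_hasDerivAt_eq_zero hbt
    (fun x hx => (hd2 x (hb.trans_le hx.1)).continuousAt.continuousWithinAt)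
    (hG1b.trans ht.symm) (fun x hx => hd2 x (hb.trans hx.1))
  have hξ' : 2 * C = p * (1 - p) * ξ ^ (p - 2) := by simp only [hG2] at hξ; linarith
  have hpp : 0 < p * (1 - p) := mul_pos hp (by linarith)
  have hξ0 : 0 < ξ := hb.trans hbξ
  -- A strictly concave `G1` with zeros `b < t` has signs `-, +, -`, so `G` falls to `0` at `b`,
  -- rises up to `t`, and falls to `0` at `1`.
  have hconc : StrictConcaveOn ℝ (Set.Ioi 0) G1 := by
    refine StrictAntiOn.strictConcaveOn_of_deriv (convex_Ioi 0)
      (fun x hx => (hd2 x hx).continuousAt.continuousWithinAt) ?_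
    rw [interior_Ioi]
    intro x hx y hy hxy
    rw [(hd2 x hx).deriv, (hd2 y hy).deriv]
    have := Real.rpow_lt_rpow_of_neg hx hxy (show p - 2 < 0 by linarith)
    simp only [hG2]
    gcongr
  have ht0 : 0 < t := hb.trans hbt
  have n1 : ∀ x, 0 < x → x < b → G1 x < 0 := by
    intro x hx hxb
    have := hconc.slope_anti_adjacent hx ht0 hxb hbt
    rw [hG1b, ht, sub_zero, zero_div, zero_sub] at this
    by_contra! h
    exact absurd this (not_lt.2 (div_nonpos_of_nonpos_of_nonneg (by linarith) (by linarith)))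
  have n2 : ∀ x, b < x → x < t → 0 < G1 x := by
    intro x hx hxt
    have := hconc.slope_anti_adjacent hb ht0 hx hxt
    rw [hG1b, ht, sub_zero, zero_sub] at this
    by_contra! h
    have h1 : 0 ≤ -G1 x / (t - x) := div_nonneg (by linarith) (by linarith)
    have h2 : G1 x / (x - b) ≤ 0 := div_nonpos_of_nonpos_of_nonneg h (by linarith)
    linarith
  have n3 : ∀ x, t < x → G1 x < 0 := by
    intro x hx
    have := hconc.slope_anti_adjacent hb (ht0.trans hx) hbt hx
    rw [hG1b, ht, sub_zero, sub_zero, zero_div] at this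
    by_contra! h
    exact absurd this (not_lt.2 (div_nonneg h (by linarith)))
  have hpos : ∀ s ∈ Set.Icc (0 : ℝ) 1, s ≠ b → s ≠ 1 → 0 < G s := by
    intro s hs hsb hs1
    have hs1' : s < 1 := lt_of_le_of_ne hs.2 hs1
    rcases lt_or_gt_of_ne hsb with h | h
    · have : StrictAntiOn G (Set.Icc 0 b) := by
        refine strictAntiOn_of_deriv_neg (convex_Icc 0 b) hGc.continuousOn ?_
        rw [interior_Icc]
        intro x hx
        rw [(hd1 x hx.1).deriv]
        exact n1 x hx.1 hx.2
      have := this ⟨hs.1, h.le⟩ ⟨hb.le, le_rfl⟩ h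
      rwa [hGb] at this
    rcases le_or_gt s t with h' | h'
    · have : StrictMonoOn G (Set.Icc b t) := by
        refine strictMonoOn_of_deriv_pos (convex_Icc b t) hGc.continuousOn ?_
        rw [interior_Icc]
        intro x hx
        rw [(hd1 x (hb.trans hx.1)).deriv]
        exact n2 x hx.1 hx.2
      have := this ⟨le_rfl, hbt.le⟩ ⟨h.le, h'⟩ h
      rwa [hGb] at this
    · have : StrictAntiOn G (Set.Icc t 1) := by
        refine strictAntiOn_of_deriv_neg (convex_Icc t 1) hGc.continuousOn ?_
        rw [interior_Icc]
        intro x hx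
        rw [(hd1 x (ht0.trans hx.1)).deriv]
        exact n3 x hx.1
      have := this ⟨h'.le, hs1'.le⟩ ⟨ht1.le, le_rfl⟩ hs1'
      rwa [hGone] at this
  refine ⟨C, ?_, ?_, by linarith, fun s hs => ?_⟩
  · have : 0 < ξ ^ (p - 2) := Real.rpow_pos_of_pos hξ0 _
    have : 0 < p * (1 - p) * ξ ^ (p - 2) := by positivity
    linarith
  · rw [hξ']
    exact mul_le_mul_of_nonneg_left
      (Real.rpow_le_rpow_of_nonpos hb hbξ.le (by linarith)) hpp.le
  · by_cases h1 : s = b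
    · subst h1; simp
    by_cases h2 : s = 1
    · subst h2; simp only [Real.one_rpow]; exact ⟨by linarith, fun _ => Or.inr trivial⟩
    have := hpos s hs h1 h2
    simp only [hG] at this
    exact ⟨by linarith, fun h => by linarith⟩

/-- A quadratic majorant of `s ^ p` on `[0, 1]`, written as a nonnegative combination of `1`, `s` and
`c - (s - 1 / D) ^ 2`, that is sharp at `b` and at `1`. -/
theorem exists_moment_certificate {p b D g M c : ℝ} (hp : 1 / 2 ≤ p) (hp1 : p ≤ 1) (hD : 1 ≤ D)
    (hg : 0 < g) (hg2 : g ≤ 2) (hb : b = 1 / (D + g)) (hM : M = D + (D ^ 2 - D) / g)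
    (hc : c = g * (D - 1) * b / D ^ 2) :
    ∃ α γ C : ℝ, 0 ≤ α ∧ 0 ≤ γ ∧ 0 ≤ C ∧ (p < 1 → 0 < α) ∧
      α + γ / D = b ^ p + (1 - b ^ p) / M ∧
      ∀ s ∈ Set.Icc (0 : ℝ) 1, s ^ p ≤ α + γ * s - C * ((s - 1 / D) ^ 2 - c) ∧
        (p < 1 → s ^ p = α + γ * s - C * ((s - 1 / D) ^ 2 - c) → s = b ∨ s = 1) := by
  have hD0 : 0 < D := by linarith
  have hM0 : 0 < M := by
    have : 0 ≤ (D ^ 2 - D) / g := div_nonneg (by nlinarith) hg.le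
    linarith
  have hb0 : 0 < b := by rw [hb]; positivity
  have hb1 : b < 1 := by rw [hb, div_lt_one (by positivity)]; linarith
  have hbD : b * (D + g) = 1 := by rw [hb]; field_simp
  have hM' : M * g = D * (D + g - 1) := by rw [hM]; field_simp; ring
  -- The law with mass `1 / M` at `1` and the rest at `b` has mean `1 / D`.
  have hmean : (1 - b) * D = M - b * M * D := by
    have : g ≠ 0 := hg.ne'
    apply mul_right_cancel₀ this
    linear_combination (-1 + b * D) * hM' + (D ^ 2 - D) * hbD
  -- At `p = 1` the majorant is `s` itself.
  rcases hp1.eq_or_lt with rfl | hp1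
  · refine ⟨0, 1, 0, le_rfl, zero_le_one, le_rfl, fun h => absurd h (lt_irrefl _), ?_,
      fun s hs => ⟨by simp, fun h => absurd h (lt_irrefl _)⟩⟩
    rw [Real.rpow_one]
    field_simp
    linarith
  obtain ⟨C, hC0, hC, hone, hmaj⟩ := exists_quadratic_majorant_rpow (by linarith) hp1 hb0 hb1
  have hpow1 : b ^ (p - 1) = b * b ^ (p - 2) := by
    rw [mul_comm, ← Real.rpow_add_one hb0.ne']; ring_nf
  have hpow : b ^ p = b ^ 2 * b ^ (p - 2) := by
    rw [← Real.rpow_natCast b 2, ← Real.rpow_add hb0]; congr 1; push_cast; ring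
  set E := b ^ (p - 2) with hE
  have hE0 : 0 < E := Real.rpow_pos_of_pos hb0 _
  -- `α` and `γ` come from expanding the quadratic around `1 / D`. Positivity of `α` combines `2 C
  -- b² ≤ p (1 - p) b ^ p` with `c - 1 / D² < b²`, the latter from `g ≤ 2` and `(1 / D - b)² > 0`.
  have hα : 0 < (1 - p) * b ^ p - C * b ^ 2 + C * (1 / D ^ 2 - c) := by
    have h1 : c - 1 / D ^ 2 < b ^ 2 := by
      have h2 : c ≤ 2 * b / D := by
        rw [hc, div_le_div_iff₀ (by positivity) hD0]
        have : g * (D - 1) ≤ 2 * D := by nlinarith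
        have := mul_le_mul_of_nonneg_right this (by positivity : 0 ≤ b * D)
        nlinarith
      have h3 : 0 < (1 / D - b) ^ 2 := by
        have : b < 1 / D := by rw [hb]; exact one_div_lt_one_div_of_lt hD0 (by linarith)
        have : 0 < 1 / D - b := by linarith
        positivity
      have h4 : (1 / D - b) ^ 2 = 1 / D ^ 2 - 2 * b / D + b ^ 2 := by ring
      linarith
    have h5 : C * (b ^ 2 + (c - 1 / D ^ 2)) < C * (2 * b ^ 2) :=
      mul_lt_mul_of_pos_left (by linarith) hC0
    have h6 : C * (2 * b ^ 2) ≤ p * (1 - p) * E * b ^ 2 := by nlinarith [sq_nonneg b]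
    have h7 : p * (1 - p) * E * b ^ 2 ≤ (1 - p) * b ^ p := by
      rw [hpow]
      have : 0 ≤ (1 - p) * (E * b ^ 2) := mul_nonneg (by linarith) (by positivity)
      nlinarith
    linarith
  -- As `1 / D - b = g b / D`, this reduces to `(1 - p) g ≤ D`, which follows from `p ≥ 1 / 2` and
  -- `g ≤ 2`.
  have hγ : 0 ≤ p * b ^ (p - 1) + 2 * C * b - 2 * C / D := by
    have h1 : 1 / D - b = g * b / D := by
      field_simp; linarith
    have h2 : 2 * C * (g * b / D) ≤ p * (1 - p) * E * (g * b / D) :=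
      mul_le_mul_of_nonneg_right hC (by positivity)
    have h3 : (1 - p) * g / D ≤ 1 := by
      rw [div_le_one hD0]; nlinarith
    have h4 : p * (1 - p) * E * (g * b / D) = p * (b * E) * ((1 - p) * g / D) := by ring
    have h5 : p * (b * E) * ((1 - p) * g / D) ≤ p * (b * E) :=
      mul_le_of_le_one_right (by positivity) h3
    rw [hpow1]
    have h6 : 2 * C / D - 2 * C * b = 2 * C * (1 / D - b) := by ring
    rw [h1] at h6
    linarith
  have key : ∀ s, (1 - p) * b ^ p - C * b ^ 2 + C * (1 / D ^ 2 - c) +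
      (p * b ^ (p - 1) + 2 * C * b - 2 * C / D) * s - C * ((s - 1 / D) ^ 2 - c) =
      b ^ p + p * b ^ (p - 1) * (s - b) - C * (s - b) ^ 2 := by
    intro s
    have : p * b ^ (p - 1) * b = p * b ^ p := by rw [hpow1, hpow]; ring
    have h2 : C * (s - 1 / D) ^ 2 = C * s ^ 2 - 2 * C / D * s + C * (1 / D ^ 2) := by ring
    linear_combination this - h2
  refine ⟨_, _, C, hα.le, hγ, hC0.le, fun _ => hα, ?_, fun s hs => ?_⟩
  · have h1 := key 1
    have h2 := key b
    rw [hone] at h1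
    simp only [sub_self, mul_zero, zero_pow two_ne_zero, add_zero, sub_zero] at h2
    set A := (1 - p) * b ^ p - C * b ^ 2 + C * (1 / D ^ 2 - c)
    set B := p * b ^ (p - 1) + 2 * C * b - 2 * C / D
    have hmean' : 1 / M + (1 - 1 / M) * b = 1 / D := by field_simp; linarith
    -- The same two-point law has variance `c`, so averaging the majorant over it yields exactly the
    -- claimed bound.
    have hvar : 1 / M * (1 - 1 / D) ^ 2 + (1 - 1 / M) * (b - 1 / D) ^ 2 = c := by
      have hb' : b - 1 / D = - (g * b / D) := by field_simp; linarith
      have e1 : 1 / M * (1 - 1 / D) = (1 - 1 / M) * (g * b / D) := by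
        rw [← neg_eq_iff_eq_neg.2 hb']
        linear_combination hmean'
      have : 1 / M * (1 - 1 / D) ^ 2 + (1 - 1 / M) * (b - 1 / D) ^ 2 =
          (1 - 1 / D) * (g * b / D) := by
        rw [hb']
        linear_combination (1 - 1 / D - g * b / D) * e1
      rw [this, hc]
      field_simp
    linear_combination (1 / M) * h1 + (1 - 1 / M) * h2 - B * hmean' + C * hvar
  · rw [key s]
    exact ⟨(hmaj s hs).1, fun _ => (hmaj s hs).2⟩

/-! ### The variance inequality and the moment bound in a Euclidean space. -/

/-- A weighted second moment matrix of size `n` satisfies `(tr T) ^ 2 ≤ n * ‖T‖ ^ 2`, stated as an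
inequality of a potential energy type. -/
theorem sq_integral_sum_sq_le_integral_prod {Ω : Type*} [MeasurableSpace Ω] {μ : Measure Ω}
    [SFinite μ] {n : ℕ} {w : Ω → ℝ} {y : Fin n → Ω → ℝ}
    (hint : ∀ i j, Integrable (fun ω => w ω * (y i ω * y j ω)) μ) :
    (∫ ω, w ω * ∑ i, y i ω ^ 2 ∂μ) ^ 2 ≤
      n * ∫ z, w z.1 * w z.2 * (∑ i, y i z.1 * y i z.2) ^ 2 ∂(μ.prod μ) := by
  set T : Fin n → Fin n → ℝ := fun i j => ∫ ω, w ω * (y i ω * y j ω) ∂μ with hT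
  have h1 : ∫ ω, w ω * ∑ i, y i ω ^ 2 ∂μ = ∑ i, T i i := by
    rw [hT, ← integral_finsetSum _ fun i _ => hint i i]
    simp only [Finset.mul_sum, sq]
  -- By independence of the two factors, the double integral is the squared Frobenius norm of `T`.
  have h2 : ∫ z, w z.1 * w z.2 * (∑ i, y i z.1 * y i z.2) ^ 2 ∂(μ.prod μ) =
      ∑ i, ∑ j, T i j ^ 2 := by
    have : ∀ z : Ω × Ω, w z.1 * w z.2 * (∑ i, y i z.1 * y i z.2) ^ 2 =
        ∑ i, ∑ j, (w z.1 * (y i z.1 * y j z.1)) * (w z.2 * (y i z.2 * y j z.2)) := by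
      intro z
      rw [sq, Finset.sum_mul_sum, Finset.mul_sum]
      refine Finset.sum_congr rfl fun i _ => ?_
      rw [Finset.mul_sum]
      exact Finset.sum_congr rfl fun j _ => by ring
    simp_rw [this]
    rw [integral_finsetSum _ fun i _ => integrable_finsetSum _ fun j _ =>
      (hint i j).mul_prod (hint i j)]
    refine Finset.sum_congr rfl fun i _ => ?_
    rw [integral_finsetSum _ fun j _ => (hint i j).mul_prod (hint i j)]
    refine Finset.sum_congr rfl fun j _ => ?_
    rw [integral_prod_mul (fun ω => w ω * (y i ω * y j ω)) (fun ω => w ω * (y i ω * y j ω)), sq]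
  rw [h1, h2]
  calc (∑ i, T i i) ^ 2 ≤ (Finset.univ : Finset (Fin n)).card * ∑ i, T i i ^ 2 :=
        sq_sum_le_card_mul_sum_sq
    _ ≤ n * ∑ i, ∑ j, T i j ^ 2 := by
        rw [Finset.card_univ, Fintype.card_fin]
        gcongr with i
        exact Finset.single_le_sum (f := fun j => T i j ^ 2) (fun j _ => sq_nonneg _)
          (Finset.mem_univ i)

section

variable {Ω : Type*} [MeasurableSpace Ω] {μ : Measure Ω}
  {V : Type*} [NormedAddCommGroup V] [InnerProductSpace ℝ V]

local notation "⟪" x ", " y "⟫" => inner ℝ x y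

/-- The orthogonal complement of a nonzero vector has an orthonormal basis. -/
theorem exists_coordinates_orthogonal [FiniteDimensional ℝ V] {e : V} (he : e ≠ 0) :
    ∃ (n : ℕ) (u : Fin n → V), n + 1 = Module.finrank ℝ V ∧ (∀ i, ⟪u i, e⟫ = 0) ∧
      ∀ v w : V, ⟪e, v⟫ = 0 → ⟪v, w⟫ = ∑ i, ⟪u i, v⟫ * ⟪u i, w⟫ := by
  obtain ⟨n, hn⟩ : ∃ n, Module.finrank ℝ V = n + 1 :=
    Nat.exists_eq_succ_of_ne_zero
      (have : Nontrivial V := ⟨e, 0, he⟩; Module.finrank_pos.ne')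
  have : Fact (Module.finrank ℝ V = n + 1) := ⟨hn⟩
  have hdim := Submodule.finrank_orthogonal_span_singleton (𝕜 := ℝ) (n := n) he
  let B := (stdOrthonormalBasis ℝ (ℝ ∙ e)ᗮ).reindex (finCongr hdim)
  refine ⟨n, fun i => (B i : V), hn.symm, fun i => ?_, fun v w hv => ?_⟩
  · rw [real_inner_comm]
    exact (Submodule.mem_orthogonal_singleton_iff_inner_right.1 (B i).2)
  · set v' : (ℝ ∙ e)ᗮ := ⟨v, Submodule.mem_orthogonal_singleton_iff_inner_right.2 hv⟩ with hv'
    have h1 : (v : V) = ∑ i, ⟪(B i : V), v⟫ • (B i : V) := by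
      have := congrArg (fun x : (ℝ ∙ e)ᗮ => (x : V)) (B.sum_repr' v').symm
      simpa using this
    conv_lhs => rw [h1]
    simp only [sum_inner, real_inner_smul_left]

theorem integrable_inner_prod [SFinite μ] [MeasurableSpace V] [BorelSpace V]
    [SecondCountableTopology V] {A B : Ω → V}
    (hA : Measurable A) (hB : Measurable B)
    (hAi : Integrable (fun ω => ‖A ω‖) μ) (hBi : Integrable (fun ω => ‖B ω‖) μ) :
    Integrable (fun z : Ω × Ω => ⟪A z.1, B z.2⟫) (μ.prod μ) := by
  refine (hAi.mul_prod hBi).mono' ?_ (Filter.Eventually.of_forall fun z => ?_)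
  · exact ((hA.comp measurable_fst).inner (hB.comp measurable_snd)).aestronglyMeasurable
  · exact abs_real_inner_le_norm _ _

/-- Integrating out the second variable replaces `X` by its mean `e / D`; only one of the two
factors has to be isotropic. -/
theorem integral_inner_prod_of_isotropic [SFinite μ] [MeasurableSpace V] [BorelSpace V]
    [SecondCountableTopology V] {A X : Ω → V} {e : V} {D : ℝ}
    (hA : Measurable A) (hX : Measurable X)
    (hAi : Integrable (fun ω => ‖A ω‖) μ) (hXi : Integrable (fun ω => ‖X ω‖) μ)
    (hE : ∀ v, ∫ ω, ⟪v, X ω⟫ ∂μ = ⟪v, e⟫ / D) :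
    ∫ z : Ω × Ω, ⟪A z.1, X z.2⟫ ∂(μ.prod μ) = (∫ ω, ⟪A ω, e⟫ ∂μ) / D := by
  rw [integral_prod _ (integrable_inner_prod hA hX hAi hXi)]
  simp only [hE]
  rw [integral_div]

/-- The pointwise estimate behind the moment bound. -/
theorem rpow_inner_le_of_certificate {p D c α γ C : ℝ} (hp : 1 / 2 ≤ p) (hp1 : p ≤ 1) (hγ : 0 ≤ γ)
    (hmaj : ∀ s ∈ Set.Icc (0 : ℝ) 1, s ^ p ≤ α + γ * s - C * ((s - 1 / D) ^ 2 - c))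
    {x y : V} (hxy : 0 ≤ ⟪x, y⟫) :
    ⟪x, y⟫ ^ p ≤ α * (‖x‖ ^ p * ‖y‖ ^ p) +
      γ * ((2 * p - 1) * ⟪x, y⟫ + (1 - p) * (⟪‖x‖⁻¹ • x, y⟫ + ⟪‖y‖⁻¹ • y, x⟫)) -
      C * (‖x‖ ^ p * ‖y‖ ^ p * (⟪‖x‖⁻¹ • x, ‖y‖⁻¹ • y⟫ - 1 / D) ^ 2 -
        c * (‖x‖ ^ p * ‖y‖ ^ p)) := by
  have hp0 : p ≠ 0 := by linarith
  by_cases hx : x = 0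
  · simp [hx, Real.zero_rpow hp0]
  by_cases hy : y = 0
  · simp [hy, Real.zero_rpow hp0]
  have hx0 : 0 < ‖x‖ := norm_pos_iff.2 hx
  have hy0 : 0 < ‖y‖ := norm_pos_iff.2 hy
  obtain ⟨s, hs⟩ : ∃ s, s = ⟪‖x‖⁻¹ • x, ‖y‖⁻¹ • y⟫ := ⟨_, rfl⟩
  have hs' : ⟪x, y⟫ = ‖x‖ * ‖y‖ * s := by
    rw [hs, real_inner_smul_left, real_inner_smul_right]; field_simp
  have hs0 : 0 ≤ s := by
    rw [hs, real_inner_smul_left, real_inner_smul_right]; positivity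
  have hs1 : s ≤ 1 := by
    have := real_inner_le_norm x y
    rw [hs'] at this
    exact le_of_mul_le_mul_left (by linarith) (mul_pos hx0 hy0)
  have e1 : ⟪‖x‖⁻¹ • x, y⟫ = ‖y‖ * s := by
    rw [real_inner_smul_left, hs']; field_simp
  have e2 : ⟪‖y‖⁻¹ • y, x⟫ = ‖x‖ * s := by
    rw [real_inner_smul_left, real_inner_comm, hs']; field_simp
  -- AM-GM with weights `2p - 1, 1 - p, 1 - p`, the first nonnegative because `p ≥ 1 / 2`. In each
  -- resulting term at least one vector keeps its full length, so isotropy applies.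
  have hw : ‖x‖ ^ p * ‖y‖ ^ p ≤
      (2 * p - 1) * (‖x‖ * ‖y‖) + (1 - p) * ‖x‖ + (1 - p) * ‖y‖ := by
    have := Real.geom_mean_le_arith_mean3_weighted (w₁ := 2 * p - 1) (w₂ := 1 - p) (w₃ := 1 - p)
      (p₁ := ‖x‖ * ‖y‖) (p₂ := ‖x‖) (p₃ := ‖y‖) (by linarith) (by linarith) (by linarith)
      (by positivity) hx0.le hy0.le (by ring)
    refine le_trans (le_of_eq ?_) this
    have hsplit : ∀ r : ℝ, 0 < r → r ^ p = r ^ (2 * p - 1) * r ^ (1 - p) := fun r hr => by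
      rw [← Real.rpow_add hr]; ring_nf
    rw [Real.mul_rpow hx0.le hy0.le, hsplit _ hx0, hsplit _ hy0]
    ring
  set W := ‖x‖ ^ p * ‖y‖ ^ p with hW
  have hW0 : 0 ≤ W := by positivity
  rw [← hs, e1, e2, hs', Real.mul_rpow (by positivity) hs0, Real.mul_rpow hx0.le hy0.le, ← hW]
  have h1 := mul_le_mul_of_nonneg_left (hmaj s ⟨hs0, hs1⟩) hW0
  have h2 := mul_le_mul_of_nonneg_left hw (mul_nonneg hγ hs0)
  linarith

/-- Moment bound for an isotropic random vector `X` in the cone over a set of unit vectors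
with nonnegative inner products lying on the hyperplane `⟪e, x⟫ = 1`. -/
theorem moment_le_of_certificate [IsProbabilityMeasure μ] [FiniteDimensional ℝ V]
    [MeasurableSpace V] [BorelSpace V] {X : Ω → V} {e : V} {p D M c α γ C : ℝ}
    (hD : 1 ≤ D) (hp : 1 / 2 ≤ p) (hp1 : p ≤ 1)
    (hα : 0 ≤ α) (hγ : 0 ≤ γ) (hC : 0 ≤ C)
    (hmaj : ∀ s ∈ Set.Icc (0 : ℝ) 1, s ^ p ≤ α + γ * s - C * ((s - 1 / D) ^ 2 - c))
    (hX : Measurable X) (hnn : ∀ ω ω', 0 ≤ ⟪X ω, X ω'⟫) (he : ⟪e, e⟫ = D)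
    (heX : ∀ ω, ⟪e, X ω⟫ = ‖X ω‖) (hXi : Integrable (fun ω => ‖X ω‖) μ)
    (hE : ∀ v, ∫ ω, ⟪v, X ω⟫ ∂μ = ⟪v, e⟫ / D)
    (hM : (Module.finrank ℝ V : ℝ) ≤ M) (hc : c = (1 - 1 / D) ^ 2 / (M - 1)) :
    Integrable (fun z : Ω × Ω => ⟪X z.1, X z.2⟫ ^ p) (μ.prod μ) ∧
    ∫ z, ⟪X z.1, X z.2⟫ ^ p ∂(μ.prod μ) ≤ α + γ / D ∧
    (0 < α → p < 1 → ∫ z, ⟪X z.1, X z.2⟫ ^ p ∂(μ.prod μ) = α + γ / D →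
      (∀ᵐ ω ∂μ, ‖X ω‖ = 1) ∧ ∀ᵐ z ∂(μ.prod μ), ⟪X z.1, X z.2⟫ ^ p =
        α + γ * ⟪X z.1, X z.2⟫ - C * ((⟪X z.1, X z.2⟫ - 1 / D) ^ 2 - c)) := by
  have hp0 : 0 < p := by linarith
  have hD0 : 0 < D := by linarith
  have he0 : e ≠ 0 := by
    rintro rfl
    simp at he; linarith
  -- `U` is the direction of `X`, with value `0` where `X = 0`.
  set U : Ω → V := fun ω => ‖X ω‖⁻¹ • X ω with hU
  have hUm : Measurable U := hX.norm.inv.smul hX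
  have hU1 : ∀ ω, ‖U ω‖ ≤ 1 := fun ω => by
    simp only [hU, norm_smul, norm_inv, norm_norm]
    exact inv_mul_le_one
  have hUi : Integrable (fun ω => ‖U ω‖) μ := by
    refine (integrable_const (1 : ℝ)).mono' hUm.norm.aestronglyMeasurable
      (Filter.Eventually.of_forall fun ω => ?_)
    rw [norm_norm]; exact hU1 ω
  set w : Ω → ℝ := fun ω => ‖X ω‖ ^ p with hw
  have hw0 : ∀ ω, 0 ≤ w ω := fun ω => by positivity
  have hwm : Measurable w := hX.norm.pow_const p
  -- Bernoulli; since `‖X‖` has mean `1`, the mean `m` of `w` is at most `1`.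
  have hbern : ∀ ω, w ω ≤ 1 + p * (‖X ω‖ - 1) := fun ω => by
    have := rpow_one_add_le_one_add_mul_self (s := ‖X ω‖ - 1) (by linarith [norm_nonneg (X ω)])
      hp0.le hp1
    simpa [hw] using this
  have hRi : Integrable (fun ω => p * (‖X ω‖ - 1)) μ :=
    (hXi.sub (integrable_const _)).const_mul p
  have hli : Integrable (fun ω => 1 + p * (‖X ω‖ - 1)) μ :=
    (integrable_const _).add hRi
  have hwi : Integrable w μ := by
    refine hli.mono' hwm.aestronglyMeasurable (Filter.Eventually.of_forall fun ω => ?_)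
    rw [Real.norm_of_nonneg (hw0 ω)]; exact hbern ω
  have hER : ∫ ω, ‖X ω‖ ∂μ = 1 := by
    simp_rw [← heX]
    rw [hE, he, div_self hD0.ne']
  have hEl : ∫ ω, 1 + p * (‖X ω‖ - 1) ∂μ = 1 := by
    rw [integral_add (integrable_const _) hRi,
      integral_const_mul, integral_sub hXi (integrable_const _), hER]
    simp
  set m := ∫ ω, w ω ∂μ with hm
  have hm0 : 0 ≤ m := integral_nonneg hw0
  have hm1 : m ≤ 1 := hEl ▸ integral_mono hwi hli hbern
  have hUe : ∀ ω, ⟪U ω, e⟫ ≤ 1 := fun ω => by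
    simp only [hU, real_inner_smul_left]
    rw [real_inner_comm, heX]; exact inv_mul_le_one
  have hUX : ∫ z : Ω × Ω, ⟪U z.1, X z.2⟫ ∂(μ.prod μ) ≤ 1 / D := by
    rw [integral_inner_prod_of_isotropic hUm hX hUi hXi hE]
    gcongr
    have : ∫ ω, ⟪U ω, e⟫ ∂μ ≤ ∫ _, (1 : ℝ) ∂μ := by
      refine integral_mono ?_ (integrable_const _) hUe
      refine hUi.mul_const ‖e‖ |>.mono' (hUm.inner measurable_const).aestronglyMeasurable
        (Filter.Eventually.of_forall fun ω => abs_real_inner_le_norm _ _)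
    simpa using this
  have hXU : ∫ z : Ω × Ω, ⟪U z.2, X z.1⟫ ∂(μ.prod μ) ≤ 1 / D := by
    rw [← integral_prod_swap] at hUX
    simpa using hUX
  have hXX : ∫ z : Ω × Ω, ⟪X z.1, X z.2⟫ ∂(μ.prod μ) = 1 / D := by
    rw [integral_inner_prod_of_isotropic hX hX hXi hXi hE]
    simp_rw [real_inner_comm, heX, hER]
  have iXX := integrable_inner_prod (μ := μ) hX hX hXi hXi
  have iUX := integrable_inner_prod (μ := μ) hUm hX hUi hXi
  have iXU : Integrable (fun z : Ω × Ω => ⟪U z.2, X z.1⟫) (μ.prod μ) := by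
    have := iUX.swap
    simpa [Function.comp_def] using this
  have iww : Integrable (fun z : Ω × Ω => w z.1 * w z.2) (μ.prod μ) := hwi.mul_prod hwi
  have hww : ∫ z : Ω × Ω, w z.1 * w z.2 ∂(μ.prod μ) = m * m := integral_prod_mul w w
  set Q : Ω × Ω → ℝ := fun z => w z.1 * w z.2 * (⟪U z.1, U z.2⟫ - 1 / D) ^ 2 with hQ
  have iQ : Integrable Q (μ.prod μ) := by
    refine iww.mul_bdd (c := 4) ?_ (Filter.Eventually.of_forall fun z => ?_)
    · have : Measurable fun z : Ω × Ω => ⟪U z.1, U z.2⟫ :=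
        (hUm.comp measurable_fst).inner (hUm.comp measurable_snd)
      exact ((this.sub_const _).pow_const 2).aestronglyMeasurable
    · have h1 : |⟪U z.1, U z.2⟫| ≤ 1 := (abs_real_inner_le_norm _ _).trans
        (mul_le_one₀ (hU1 _) (norm_nonneg _) (hU1 _))
      have h2 : |1 / D| ≤ 1 := by
        rw [abs_of_pos (by positivity), div_le_one hD0]; exact hD
      rw [norm_pow, Real.norm_eq_abs]
      have := (abs_sub _ _).trans (add_le_add h1 h2)
      calc |⟪U z.1, U z.2⟫ - 1 / D| ^ 2 ≤ (1 + 1) ^ 2 := by gcongr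
        _ = 4 := by norm_num
  -- Where `X ≠ 0`, the vector `U - e / D` has squared length `1 - 1 / D` and lies in the complement
  -- of `e`, of dimension `n ≤ M - 1`.
  have hQm : c * (m * m) ≤ ∫ z, Q z ∂(μ.prod μ) := by
    have hQ0 : 0 ≤ ∫ z, Q z ∂(μ.prod μ) := integral_nonneg fun z =>
      mul_nonneg (mul_nonneg (hw0 _) (hw0 _)) (sq_nonneg _)
    obtain ⟨n, u, hn, hue, hu⟩ := exists_coordinates_orthogonal he0
    have hYU : ∀ ω ω', X ω ≠ 0 → X ω' ≠ 0 →
        ⟪U ω, U ω'⟫ - 1 / D = ∑ i, ⟪u i, U ω⟫ * ⟪u i, U ω'⟫ := by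
      intro ω ω' h h'
      have hUe1 : ∀ ω, X ω ≠ 0 → ⟪e, U ω⟫ = 1 := fun ω h => by
        simp only [hU, real_inner_smul_right, heX]
        exact inv_mul_cancel₀ (norm_ne_zero_iff.2 h)
      have := hu (U ω - (1 / D) • e) (U ω' - (1 / D) • e) (by
        rw [inner_sub_right, hUe1 ω h, real_inner_smul_right, he]; field_simp; simp)
      simp only [inner_sub_right, inner_sub_left, real_inner_smul_left, real_inner_smul_right, hue,
        mul_zero, sub_zero, he, hUe1 ω' h', real_inner_comm e (U ω), hUe1 ω h] at this
      rw [← this]; field_simp; ring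
    have hUU : ∀ ω, X ω ≠ 0 → ⟪U ω, U ω⟫ = 1 := fun ω h => by
      rw [real_inner_self_eq_norm_sq]
      simp only [hU, norm_smul, norm_inv, norm_norm]
      rw [inv_mul_cancel₀ (norm_ne_zero_iff.2 h), one_pow]
    have hw_zero : ∀ ω, X ω = 0 → w ω = 0 := fun ω h => by
      simp [hw, h, Real.zero_rpow hp0.ne']
    have hy : ∀ i, Measurable fun ω => ⟪u i, U ω⟫ := fun i => measurable_const.inner hUm
    have hyb : ∀ i ω, |⟪u i, U ω⟫| ≤ ‖u i‖ := fun i ω =>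
      (abs_real_inner_le_norm _ _).trans (mul_le_of_le_one_right (norm_nonneg _) (hU1 ω))
    have key := sq_integral_sum_sq_le_integral_prod (μ := μ) (w := w)
      (y := fun i ω => ⟪u i, U ω⟫) (fun i j => by
        refine hwi.mul_bdd (c := ‖u i‖ * ‖u j‖) ((hy i).mul (hy j)).aestronglyMeasurable
          (Filter.Eventually.of_forall fun ω => ?_)
        rw [norm_mul, Real.norm_eq_abs, Real.norm_eq_abs]
        exact mul_le_mul (hyb i ω) (hyb j ω) (abs_nonneg _) (norm_nonneg _))
    have k1 : ∀ ω, w ω * ∑ i, ⟪u i, U ω⟫ ^ 2 = w ω * (1 - 1 / D) := fun ω => by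
      by_cases h : X ω = 0
      · simp [hw_zero ω h]
      · have := hYU ω ω h h
        rw [hUU ω h] at this
        rw [this]; simp only [sq]
    have k2 : ∀ z : Ω × Ω, w z.1 * w z.2 * (∑ i, ⟪u i, U z.1⟫ * ⟪u i, U z.2⟫) ^ 2 = Q z := by
      intro z
      by_cases h : X z.1 = 0
      · simp [hQ, hw_zero _ h]
      by_cases h' : X z.2 = 0
      · simp [hQ, hw_zero _ h']
      simp only [hQ, hYU _ _ h h']
    simp_rw [k1, k2] at key
    rw [integral_mul_const, ← hm] at key
    have hn' : (n : ℝ) ≤ M - 1 := by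
      have : (n : ℝ) + 1 = Module.finrank ℝ V := by exact_mod_cast hn
      linarith
    -- If `M = 1`, division by zero makes `c = 0` and the claim is trivial.
    rcases ((Nat.cast_nonneg n).trans hn').eq_or_lt with h | h
    · rw [hc, ← h, div_zero, zero_mul]; exact hQ0
    · rw [hc, div_mul_eq_mul_div, div_le_iff₀ h]
      have := mul_le_mul_of_nonneg_right hn' hQ0
      linarith
  set F : Ω × Ω → ℝ := fun z => α * (w z.1 * w z.2) +
      γ * ((2 * p - 1) * ⟪X z.1, X z.2⟫ + (1 - p) * (⟪U z.1, X z.2⟫ + ⟪U z.2, X z.1⟫)) -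
      C * (Q z - c * (w z.1 * w z.2)) with hF
  have hFle : ∀ z : Ω × Ω, ⟪X z.1, X z.2⟫ ^ p ≤ F z := fun z =>
    rpow_inner_le_of_certificate hp hp1 hγ hmaj (hnn _ _)
  have i1 := iww.const_mul α
  have i2a := iXX.const_mul (2 * p - 1)
  have i2b : Integrable (fun z : Ω × Ω => (1 - p) * (⟪U z.1, X z.2⟫ + ⟪U z.2, X z.1⟫))
    (μ.prod μ) := (iUX.add iXU).const_mul (1 - p)
  have i2 : Integrable (fun z : Ω × Ω => γ * ((2 * p - 1) * ⟪X z.1, X z.2⟫ +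
    (1 - p) * (⟪U z.1, X z.2⟫ + ⟪U z.2, X z.1⟫))) (μ.prod μ) := (i2a.add i2b).const_mul γ
  have i12 : Integrable (fun z : Ω × Ω => α * (w z.1 * w z.2) + γ * ((2 * p - 1) *
    ⟪X z.1, X z.2⟫ + (1 - p) * (⟪U z.1, X z.2⟫ + ⟪U z.2, X z.1⟫))) (μ.prod μ) := i1.add i2
  have i3 : Integrable (fun z : Ω × Ω => C * (Q z - c * (w z.1 * w z.2))) (μ.prod μ) :=
    (iQ.sub (iww.const_mul c)).const_mul C
  have iF : Integrable F (μ.prod μ) := i12.sub i3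
  have hFint : ∫ z, F z ∂(μ.prod μ) ≤ α * (m * m) + γ / D := by
    have : ∫ z, F z ∂(μ.prod μ) = α * (m * m) + γ * ((2 * p - 1) * (1 / D) + (1 - p) *
        (∫ z : Ω × Ω, ⟪U z.1, X z.2⟫ ∂(μ.prod μ) + ∫ z : Ω × Ω, ⟪U z.2, X z.1⟫ ∂(μ.prod μ))) -
        C * (∫ z, Q z ∂(μ.prod μ) - c * (m * m)) := by
      rw [integral_sub i12 i3, integral_add i1 i2, integral_const_mul, integral_const_mul,
        integral_const_mul, integral_add i2a i2b, integral_const_mul, integral_const_mul,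
        integral_add iUX iXU, integral_sub iQ (iww.const_mul c), integral_const_mul, hww, hXX]
    rw [this]
    have h1 : γ * ((2 * p - 1) * (1 / D) + (1 - p) *
        (∫ z : Ω × Ω, ⟪U z.1, X z.2⟫ ∂(μ.prod μ) + ∫ z : Ω × Ω, ⟪U z.2, X z.1⟫ ∂(μ.prod μ))) ≤
        γ * ((2 * p - 1) * (1 / D) + (1 - p) * (1 / D + 1 / D)) := by
      have : 0 ≤ 1 - p := by linarith
      gcongr
    have h2 : 0 ≤ C * (∫ z, Q z ∂(μ.prod μ) - c * (m * m)) :=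
      mul_nonneg hC (by linarith)
    have h3 : γ * ((2 * p - 1) * (1 / D) + (1 - p) * (1 / D + 1 / D)) = γ / D := by ring
    linarith
  have hSm : Measurable fun z : Ω × Ω => ⟪X z.1, X z.2⟫ ^ p :=
    ((hX.comp measurable_fst).inner (hX.comp measurable_snd)).pow_const p
  have iS : Integrable (fun z : Ω × Ω => ⟪X z.1, X z.2⟫ ^ p) (μ.prod μ) := by
    refine iF.mono' hSm.aestronglyMeasurable (Filter.Eventually.of_forall fun z => ?_)
    rw [Real.norm_of_nonneg (Real.rpow_nonneg (hnn _ _) _)]; exact hFle z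
  have hmm : m * m ≤ 1 := mul_le_one₀ hm1 hm0 hm1
  have hSF := integral_mono iS iF hFle
  refine ⟨iS, ?_, fun hα0 hp1' heq => ?_⟩
  · have := mul_le_mul_of_nonneg_left hmm hα
    linarith
  -- Equality forces `m = 1` because `α > 0`; strict Bernoulli then gives `‖X‖ = 1` almost surely.
  have hm_one : m = 1 := by
    have : 1 ≤ m * m := by
      have : α * 1 ≤ α * (m * m) := by linarith
      exact le_of_mul_le_mul_left this hα0
    nlinarith
  have hR : ∀ᵐ ω ∂μ, ‖X ω‖ = 1 := by
    have h1 : (fun ω => 1 + p * (‖X ω‖ - 1) - w ω) =ᵐ[μ] 0 := by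
      refine (integral_eq_zero_iff_of_nonneg (fun ω => sub_nonneg.2 (hbern ω)) (hli.sub hwi)).1 ?_
      rw [integral_sub hli hwi, hEl, ← hm, hm_one, sub_self]
    filter_upwards [h1] with ω hω
    by_contra h
    have := rpow_one_add_lt_one_add_mul_self (s := ‖X ω‖ - 1) (by linarith [norm_nonneg (X ω)])
      (sub_ne_zero.2 h) hp0 hp1'
    simp only [hw, Pi.zero_apply] at hω
    rw [add_sub_cancel] at this
    linarith
  refine ⟨hR, ?_⟩
  have h1 : (fun z => F z - ⟪X z.1, X z.2⟫ ^ p) =ᵐ[μ.prod μ] 0 := by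
    refine (integral_eq_zero_iff_of_nonneg (fun z => sub_nonneg.2 (hFle z)) (iF.sub iS)).1 ?_
    rw [integral_sub iF iS]
    have := integral_mono iS iF hFle
    rw [hm_one] at hFint
    linarith
  filter_upwards [h1, Measure.quasiMeasurePreserving_fst.ae hR,
    Measure.quasiMeasurePreserving_snd.ae hR] with z hz hz1 hz2
  simp only [hF, hQ, hw, hU, hz1, hz2, Real.one_rpow, inv_one, one_smul, Pi.zero_apply,
    real_inner_comm (X z.1) (X z.2)] at hz
  linarith

end

/-! ### The case of equality. -/

section

local notation "⟪" x ", " y "⟫" => inner ℝ x y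

/-- If almost all pairs of values of an isotropic random vector on the unit sphere are equal or
have inner product `b`, then the vector is uniformly distributed over a finite set of vectors with
pairwise inner products `b`. -/
theorem exists_uniform_of_ae_inner_eq {Ω : Type*} [MeasurableSpace Ω] {μ : Measure Ω}
    [IsProbabilityMeasure μ] {V : Type*} [NormedAddCommGroup V] [InnerProductSpace ℝ V]
    [MeasurableSpace V] [BorelSpace V] {X : Ω → V} {e : V} {D b : ℝ} {M : ℕ}
    (hX : Measurable X) (heX : ∀ ω, ⟪e, X ω⟫ = ‖X ω‖)
    (hE : ∀ v, ∫ ω, ⟪v, X ω⟫ ∂μ = ⟪v, e⟫ / D)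
    (h1 : ∀ᵐ ω ∂μ, ‖X ω‖ = 1)
    (h2 : ∀ᵐ z ∂(μ.prod μ), ⟪X z.1, X z.2⟫ = b ∨ ⟪X z.1, X z.2⟫ = 1)
    (hb : b < 1) (hM : 0 < M) (hMb : 1 / (M : ℝ) + (1 - 1 / M) * b = 1 / D) :
    ∃ v : Fin M → V, (∀ i j, i ≠ j → ⟪v i, v j⟫ = b) ∧ (∀ i, ‖v i‖ = 1) ∧
      (∀ i, μ (X ⁻¹' {v i}) = (M : ENNReal)⁻¹) ∧ ∀ᵐ ω ∂μ, ∃ i, X ω = v i := by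
  have hM0 : (M : ENNReal) ≠ 0 := by exact_mod_cast hM.ne'
  have hMtop : (M : ENNReal) ≠ ⊤ := ENNReal.natCast_ne_top M
  set Z : Set V := {v | μ (X ⁻¹' {v}) = (M : ENNReal)⁻¹} with hZ
  have hms : ∀ v, MeasurableSet (X ⁻¹' {v}) := fun v => hX (measurableSet_singleton v)
  have hXZ : ∀ᵐ ω ∂μ, X ω ∈ Z := by
    filter_upwards [h1, Measure.ae_ae_of_ae_prod h2] with ω hω hω2
    -- Integrating this identity gives `1 / D = b + (1 - b) μ(X = X ω)`, so the atom at `X ω` has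
    -- mass `1 / M`.
    have hind : (fun ω' => ⟪X ω, X ω'⟫) =ᵐ[μ]
        fun ω' => b + (X ⁻¹' {X ω}).indicator (fun _ => 1 - b) ω' := by
      filter_upwards [h1, hω2] with ω' hω' h
      by_cases hx : X ω' = X ω
      · simp [Set.indicator, hx, hω]
      · have h3 : ⟪X ω, X ω'⟫ ≠ 1 := fun h3 =>
          hx ((inner_eq_one_iff_of_norm_eq_one hω hω').1 h3).symm
        simp [Set.indicator, hx, h.resolve_right h3]
    have hint := integral_congr_ae hind
    rw [hE, real_inner_comm, heX, hω, integral_add (integrable_const _)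
      ((integrable_const _).indicator (hms _)), integral_indicator_const _ (hms _)] at hint
    simp only [integral_const, probReal_univ, smul_eq_mul, one_mul] at hint
    have hreal : μ.real (X ⁻¹' {X ω}) = (M : ℝ)⁻¹ := by
      have : (μ.real (X ⁻¹' {X ω}) - (M : ℝ)⁻¹) * (1 - b) = 0 := by
        rw [one_div] at hMb
        linear_combination -hMb - hint
      rcases mul_eq_zero.1 this with h | h <;> linarith
    show μ (X ⁻¹' {X ω}) = (M : ENNReal)⁻¹
    rw [← ENNReal.toReal_eq_toReal_iff' (measure_ne_top _ _) (ENNReal.inv_ne_top.2 hM0)]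
    simpa [Measure.real] using hreal
  have hfin : ∀ T : Finset V, ↑T ⊆ Z → μ (X ⁻¹' (T : Set V)) = T.card * (M : ENNReal)⁻¹ := by
    intro T hT
    have : X ⁻¹' (T : Set V) = ⋃ v ∈ T, X ⁻¹' {v} := by ext; simp
    rw [this, measure_biUnion_finset (fun v _ w _ hvw => Disjoint.preimage _ (by simpa using hvw))
      fun v _ => hms v, Finset.sum_congr rfl fun v hv => hT hv, Finset.sum_const, nsmul_eq_mul]
  have hZfin : Z.Finite := by
    by_contra hinf
    obtain ⟨T, hT, hcard⟩ := Set.Infinite.exists_subset_card_eq hinf (M + 1)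
    have h3 := hfin T hT
    have h4 : μ (X ⁻¹' (T : Set V)) ≤ 1 := prob_le_one
    rw [h3, hcard, ← div_eq_mul_inv, ENNReal.div_le_iff hM0 hMtop, one_mul] at h4
    have : M + 1 ≤ M := by exact_mod_cast h4
    omega
  have hcard : hZfin.toFinset.card = M := by
    have h3 := hfin hZfin.toFinset (by simp)
    have h4 : μ (X ⁻¹' Z) = 1 := (prob_compl_eq_zero_iff (hX hZfin.measurableSet)).1 hXZ
    rw [Set.Finite.coe_toFinset, h4, ← div_eq_mul_inv, eq_comm,
      ENNReal.div_eq_one_iff hM0 hMtop] at h3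
    exact_mod_cast h3
  let E : Fin M ≃ hZfin.toFinset := (Finset.equivFinOfCardEq hcard).symm
  have hEZ : ∀ i, (E i : V) ∈ Z := fun i => hZfin.mem_toFinset.1 (E i).2
  -- Points of `Z` have positive mass, so an almost sure property holds at some `ω` over each of
  -- them.
  have hex : ∀ {P : Ω → Prop}, (∀ᵐ ω ∂μ, P ω) → ∀ v ∈ Z, ∃ ω, X ω = v ∧ P ω := by
    intro P hP v hv
    by_contra! hcon
    have h3 : μ (X ⁻¹' {v}) = 0 :=
      measure_mono_null (fun ω hω => hcon ω hω) (ae_iff.1 hP)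
    rw [show μ (X ⁻¹' {v}) = _ from hv] at h3
    exact ENNReal.inv_ne_zero.2 hMtop h3
  have hnorm : ∀ v ∈ Z, ‖v‖ = 1 := fun v hv => by
    obtain ⟨ω, rfl, h⟩ := hex h1 v hv
    exact h
  refine ⟨fun i => E i, fun i j hij => ?_, fun i => hnorm _ (hEZ i), fun i => hEZ i, ?_⟩
  · obtain ⟨ω, hω, h3⟩ := hex (Measure.ae_ae_of_ae_prod h2) _ (hEZ i)
    obtain ⟨ω', hω', h4⟩ := hex h3 _ (hEZ j)
    rw [hω, hω'] at h4
    refine h4.resolve_right fun h5 => hij (E.injective (Subtype.ext ?_))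
    exact (inner_eq_one_iff_of_norm_eq_one (hnorm _ (hEZ i)) (hnorm _ (hEZ j))).1 h5
  · filter_upwards [hXZ] with ω hω
    exact ⟨E.symm ⟨X ω, hZfin.mem_toFinset.2 hω⟩, by simp⟩

end

/-! ### Hermitian matrices over `ℝ`, `ℂ` and `ℍ`. -/

/-- `re` is a real part functional: the properties common to `ℝ`, `ℂ` and the quaternions. -/
structure IsRealPart {K : Type*} [NormedDivisionRing K] [StarRing K] [NormedAlgebra ℝ K]
    (re : K →ₗ[ℝ] ℝ) : Prop where
  map_one : re 1 = 1
  map_mul_comm : ∀ a b, re (a * b) = re (b * a)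
  map_star : ∀ a, re (star a) = re a
  star_mul_self : ∀ a, star a * a = (‖a‖ ^ 2 : ℝ) • (1 : K)
  eq_smul_one : ∀ a, star a = a → a = re a • (1 : K)

namespace IsRealPart

variable {K : Type*} [NormedDivisionRing K] [StarRing K] [NormedAlgebra ℝ K]
  {re : K →ₗ[ℝ] ℝ}

theorem re_star_mul_self (h : IsRealPart re) (a : K) : re (star a * a) = ‖a‖ ^ 2 := by
  rw [h.star_mul_self, map_smul, h.map_one, smul_eq_mul, mul_one]

theorem norm_star (h : IsRealPart re) (a : K) : ‖star a‖ = ‖a‖ := by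
  have h1 := h.re_star_mul_self (star a)
  rw [star_star, h.map_mul_comm, h.re_star_mul_self] at h1
  exact ((sq_eq_sq₀ (norm_nonneg _) (norm_nonneg _)).1 h1).symm

theorem mul_star_self (h : IsRealPart re) (a : K) : a * star a = (‖a‖ ^ 2 : ℝ) • (1 : K) := by
  have h1 := h.star_mul_self (star a)
  rwa [star_star, h.norm_star] at h1

theorem re_star_mul_comm (h : IsRealPart re) (a b : K) : re (star a * b) = re (star b * a) := by
  rw [← h.map_star, star_mul, star_star]

theorem hermProd_self {K : Type} [NormedDivisionRing K] [StarRing K] [NormedAlgebra ℝ K]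
    {re : K →ₗ[ℝ] ℝ} (h : IsRealPart re) {d : ℕ} (x : Fin d → K) :
    hermProd x x = (∑ k, ‖x k‖ ^ 2 : ℝ) • (1 : K) := by
  simp only [hermProd, h.star_mul_self, Finset.sum_smul]

/-- The inner product `Re tr (A* B)` on Hermitian matrices. -/
@[reducible] noncomputable def hermitianCore [StarModule ℝ K] (h : IsRealPart re) (d : ℕ) :
    InnerProductSpace.Core ℝ (selfAdjoint.submodule ℝ (Matrix (Fin d) (Fin d) K)) where
  inner A B := ∑ i, ∑ j, re (star (A.1 i j) * B.1 i j)
  conj_inner_symm A B := by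
    simp only [conj_trivial]
    exact Finset.sum_congr rfl fun i _ => Finset.sum_congr rfl fun j _ => h.re_star_mul_comm _ _
  re_inner_nonneg A := by
    simp only [h.re_star_mul_self, RCLike.re_to_real]
    positivity
  add_left A B C := by
    simp [add_mul, Finset.sum_add_distrib]
  smul_left A B r := by
    simp [Finset.mul_sum]
  definite A hA := by
    simp only [h.re_star_mul_self] at hA
    rw [Finset.sum_eq_zero_iff_of_nonneg fun i _ => by positivity] at hA
    ext i j
    have h1 := hA i (Finset.mem_univ i)
    rw [Finset.sum_eq_zero_iff_of_nonneg fun i _ => by positivity] at h1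
    simpa using h1 j (Finset.mem_univ j)

/-- A Hermitian matrix is determined by its diagonal, which is real, and its entries below the
diagonal. -/
theorem finrank_hermitian_le [StarModule ℝ K] [FiniteDimensional ℝ K] (h : IsRealPart re)
    (d : ℕ) :
    Module.finrank ℝ (selfAdjoint.submodule ℝ (Matrix (Fin d) (Fin d) K)) ≤
      d + (d ^ 2 - d) / 2 * Module.finrank ℝ K := by
  let f : selfAdjoint.submodule ℝ (Matrix (Fin d) (Fin d) K) →ₗ[ℝ]
      (Fin d → ℝ) × (((i : Fin d) × Fin i) → K) :=
    { toFun := fun A => (fun i => re (A.1 i i), fun p => A.1 p.1 ⟨p.2, p.2.2.trans p.1.2⟩)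
      map_add' := fun A B => by ext <;> simp
      map_smul' := fun r A => by ext <;> simp }
  have hstar : ∀ A : selfAdjoint.submodule ℝ (Matrix (Fin d) (Fin d) K), ∀ i j,
      star (A.1 j i) = A.1 i j := fun A i j => by
    have h1 : star A.1 = A.1 := A.2
    exact congrFun (congrFun h1 i) j
  have hf : Function.Injective f := by
    intro A B hAB
    have h1 : ∀ i, re (A.1 i i) = re (B.1 i i) := fun i => congrFun (congrArg Prod.fst hAB) i
    have h2 : ∀ i j : Fin d, j < i → A.1 i j = B.1 i j := fun i j hij =>
      congrFun (congrArg Prod.snd hAB) ⟨i, ⟨j, hij⟩⟩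
    ext i j
    rcases lt_trichotomy i j with hij | rfl | hij
    · rw [← hstar A, ← hstar B, h2 j i hij]
    · rw [h.eq_smul_one _ (hstar A i i), h.eq_smul_one _ (hstar B i i), h1]
    · exact h2 i j hij
  refine (LinearMap.finrank_le_finrank_of_injective hf).trans (le_of_eq ?_)
  rw [Module.finrank_prod, Module.finrank_fin_fun, Module.finrank_pi_fintype]
  simp only [Finset.sum_const, Finset.card_univ, Fintype.card_sigma, Fintype.card_fin,
    smul_eq_mul]
  rw [Fin.sum_univ_eq_sum_range (fun i => i), Finset.sum_range_id, sq, Nat.mul_sub_one]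

/-- The map `x ↦ x x*` into the Euclidean space of Hermitian matrices. -/
theorem exists_hermitian_space {K : Type} [NormedDivisionRing K] [StarRing K] [NormedAlgebra ℝ K]
    {re : K →ₗ[ℝ] ℝ} [StarModule ℝ K] [FiniteDimensional ℝ K] (h : IsRealPart re) (d : ℕ) :
    ∃ (V : Type) (_ : NormedAddCommGroup V) (_ : InnerProductSpace ℝ V)
      (_ : FiniteDimensional ℝ V) (e : V) (X : (Fin d → K) → V),
      inner ℝ e e = (d : ℝ) ∧
      (∀ x, inner ℝ e (X x) = ‖X x‖) ∧
      (∀ x, ‖X x‖ = ∑ k, ‖x k‖ ^ 2) ∧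
      (∀ x y, inner ℝ (X x) (X y) = ‖hermProd x y‖ ^ 2) ∧
      (∀ x y, X x = X y ↔ ∀ i j, x i * star (x j) = y i * star (y j)) ∧
      Module.finrank ℝ V ≤ d + (d ^ 2 - d) / 2 * Module.finrank ℝ K ∧
      ∀ v, ∃ a : Fin d → Fin d → K,
        (∀ x, inner ℝ v (X x) = ∑ i, ∑ j, re (a i j * (x i * star (x j)))) ∧
        inner ℝ v e = ∑ i, re (a i i) := by
  let core := h.hermitianCore d
  let : NormedAddCommGroup (selfAdjoint.submodule ℝ (Matrix (Fin d) (Fin d) K)) :=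
    core.toNormedAddCommGroup
  let : InnerProductSpace ℝ (selfAdjoint.submodule ℝ (Matrix (Fin d) (Fin d) K)) :=
    InnerProductSpace.ofCore core.toCore
  have hinner : ∀ A B : selfAdjoint.submodule ℝ (Matrix (Fin d) (Fin d) K),
      inner ℝ A B = ∑ i, ∑ j, re (star (A.1 i j) * B.1 i j) := fun _ _ => rfl
  let X : (Fin d → K) → selfAdjoint.submodule ℝ (Matrix (Fin d) (Fin d) K) := fun x =>
    ⟨Matrix.of fun i j => x i * star (x j), by
      show star (Matrix.of fun i j => x i * star (x j)) = _
      ext i j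
      simp [Matrix.star_apply]⟩
  let e : selfAdjoint.submodule ℝ (Matrix (Fin d) (Fin d) K) := ⟨1, star_one _⟩
  have hXX : ∀ x y, inner ℝ (X x) (X y) = ‖hermProd x y‖ ^ 2 := by
    intro x y
    rw [hinner, ← h.norm_star, ← h.re_star_mul_self, star_star]
    simp only [hermProd, star_sum, star_mul, star_star, Finset.sum_mul_sum, map_sum, X,
      Matrix.of_apply]
    refine Finset.sum_congr rfl fun i _ => Finset.sum_congr rfl fun j _ => ?_
    rw [mul_assoc, h.map_mul_comm]
    simp only [mul_assoc]
  have heX : ∀ x, inner ℝ e (X x) = ∑ k, ‖x k‖ ^ 2 := by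
    intro x
    rw [hinner]
    refine Finset.sum_congr rfl fun i _ => ?_
    rw [Finset.sum_eq_single i (fun j _ hj => by simp [e, Matrix.one_apply_ne' hj]) (by simp)]
    simp [e, X, h.mul_star_self, h.map_one]
  have hXn : ∀ x, ‖X x‖ = ∑ k, ‖x k‖ ^ 2 := by
    intro x
    have h0 : 0 ≤ ∑ k, ‖x k‖ ^ 2 := by positivity
    rw [← sq_eq_sq₀ (norm_nonneg _) h0, ← real_inner_self_eq_norm_sq, hXX, h.hermProd_self,
      norm_smul, norm_one, mul_one, Real.norm_of_nonneg h0]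
  refine ⟨_, inferInstance, inferInstance, inferInstance, e, X, ?_, fun x => ?_, hXn, hXX,
    fun x y => ?_, h.finrank_hermitian_le d, fun v => ⟨fun i j => star (v.1 i j), ?_, ?_⟩⟩
  · rw [hinner]
    have : ∀ i : Fin d, ∑ j, re (star ((e.1 : Matrix (Fin d) (Fin d) K) i j) * e.1 i j) = 1 := by
      intro i
      rw [Finset.sum_eq_single i (fun j _ hj => by simp [e, Matrix.one_apply_ne' hj]) (by simp)]
      simp [e, h.map_one]
    simp [this]
  · rw [heX, hXn]
  · rw [Subtype.ext_iff, ← Matrix.ext_iff]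
    rfl
  · intro x
    rw [hinner]
    rfl
  · rw [hinner]
    refine Finset.sum_congr rfl fun i _ => ?_
    rw [Finset.sum_eq_single i (fun j _ hj => by simp [e, Matrix.one_apply_ne' hj]) (by simp)]
    simp [e]

end IsRealPart

theorem isRealPart_real : IsRealPart (LinearMap.id : ℝ →ₗ[ℝ] ℝ) where
  map_one := rfl
  map_mul_comm := mul_comm
  map_star _ := rfl
  star_mul_self a := by simp [sq]
  eq_smul_one a _ := by simp

theorem isRealPart_complex : IsRealPart Complex.reLm where
  map_one := by simp
  map_mul_comm a b := by rw [mul_comm]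
  map_star a := by simp
  star_mul_self a := by
    have := Complex.conj_mul' a
    simpa using this
  eq_smul_one a ha := by
    have := Complex.conj_eq_iff_re.1 ha
    simp [this]

/-- The real part of a quaternion as a linear map. -/
noncomputable def quaternionReLm : ℍ[ℝ] →ₗ[ℝ] ℝ where
  toFun a := a.re
  map_add' _ _ := rfl
  map_smul' _ _ := rfl

theorem quaternionReLm_apply (a : ℍ[ℝ]) : quaternionReLm a = a.re := rfl

theorem isRealPart_quaternion : IsRealPart quaternionReLm where
  map_one := rfl
  map_mul_comm a b := by simp only [quaternionReLm_apply, Quaternion.re_mul]; ring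
  map_star a := by simp only [quaternionReLm_apply, Quaternion.re_star]
  star_mul_self a := by
    rw [Quaternion.star_mul_self, Quaternion.normSq_eq_norm_mul_self, sq]
    ext <;> simp
  eq_smul_one a ha := by
    have h := Quaternion.star_eq_self.1 ha
    conv_lhs => rw [h]
    ext <;> simp [quaternionReLm_apply]

instance quaternionStarModule : StarModule ℝ ℍ[ℝ] where
  star_smul r a := by ext <;> simp

theorem maxSimplexSize_cast {K : Type} [NormedDivisionRing K] [NormedAlgebra ℝ K] (d : ℕ) :
    (maxSimplexSize K d : ℝ) =
      d + ((d : ℝ) ^ 2 - d) / (2 * (Module.finrank ℝ K : ℝ)⁻¹) := by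
  have h2 : 2 ∣ d ^ 2 - d := by
    rw [sq, ← Nat.mul_sub_one]
    exact (Nat.even_mul_pred_self d).two_dvd
  have hle : d ≤ d ^ 2 := Nat.le_self_pow two_ne_zero d
  rw [maxSimplexSize, Nat.cast_add, Nat.cast_mul, Nat.cast_div h2 two_ne_zero, Nat.cast_sub hle]
  push_cast
  rw [← div_div, div_inv_eq_mul]

/-! ### From Hermitian matrices back to lines in `K ^ d`. -/

section

variable {K : Type} [NormedDivisionRing K] [StarRing K] [NormedAlgebra ℝ K]
  {re : K →ₗ[ℝ] ℝ} {d : ℕ}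

namespace IsRealPart

/-- A vector has the same projector `x x*` as the unit vector `x` exactly if it is a unit
representative of the same line. -/
theorem mem_unitRepresentatives_iff (h : IsRealPart re) {x y : Fin d → K}
    (hx : ∑ k, ‖x k‖ ^ 2 = 1) (hy : ∑ k, ‖y k‖ ^ 2 = ∑ k, ‖x k‖ ^ 2) :
    y ∈ unitRepresentatives x ↔ ∀ i j, y i * star (y j) = x i * star (x j) := by
  constructor
  · rintro ⟨c, hc, hyx⟩ i j
    rw [hyx, hyx, star_mul, mul_assoc, ← mul_assoc c, h.mul_star_self, hc]
    simp
  · intro hyx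
    have hself : hermProd y y = 1 := by rw [h.hermProd_self, hy, hx, one_smul]
    have hxself : hermProd x x = 1 := by rw [h.hermProd_self, hx, one_smul]
    -- From `y y* = x x*` and `y* y = 1` follows `y = y (y* y) = x (x* y)`.
    have hrep : ∀ k, y k = x k * hermProd x y := fun k => by
      calc y k = y k * hermProd y y := by rw [hself, mul_one]
        _ = x k * hermProd x y := by
          simp only [hermProd, Finset.mul_sum, ← mul_assoc, hyx]
    refine ⟨hermProd x y, ?_, hrep⟩
    have h1 : ∑ k, ‖y k‖ ^ 2 = (∑ k, ‖x k‖ ^ 2) * ‖hermProd x y‖ ^ 2 := by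
      rw [Finset.sum_mul]
      exact Finset.sum_congr rfl fun k _ => by
        conv_lhs => rw [hrep k, norm_mul, mul_pow]
    rw [hy, hx, one_mul] at h1
    exact (pow_eq_one_iff_of_nonneg (norm_nonneg _) two_ne_zero).1 h1.symm

/-- If two of the lines coincided, the scalar relating their unit vectors would be their product, of
squared modulus `b < 1`, yet also of modulus `1`. -/
theorem isRegularSimplex_of_norm_sq (h : IsRealPart re) {N : ℕ} {x : Fin N → Fin d → K} {b : ℝ}
    (hb : b < 1) (hx : ∀ i, ∑ k, ‖x i k‖ ^ 2 = 1)
    (hij : ∀ i j, i ≠ j → ‖hermProd (x i) (x j)‖ ^ 2 = b) : IsRegularSimplex x := by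
  have hunit : ∀ i, hermProd (x i) (x i) = 1 := fun i => by
    rw [h.hermProd_self, hx, one_smul]
  refine ⟨hunit, fun i j hne c hc => ?_, √b, fun i j hne => ?_⟩
  · have h1 : hermProd (x i) (x j) = c := by
      calc hermProd (x i) (x j) = hermProd (x i) (x i) * c := by
            simp only [hermProd, hc, Finset.sum_mul, mul_assoc]
        _ = c := by rw [hunit, one_mul]
    have h2 : ∑ k, ‖x j k‖ ^ 2 = (∑ k, ‖x i k‖ ^ 2) * ‖c‖ ^ 2 := by
      simp only [hc, norm_mul, mul_pow, Finset.sum_mul]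
    rw [hx, hx, one_mul, ← h1, hij i j hne] at h2
    linarith
  · rw [← hij i j hne, Real.sqrt_sq (norm_nonneg _)]

/-- The moment bound and the case of equality for a coefficient algebra with a real part. -/
theorem moment_bound [StarModule ℝ K] [ContinuousStar K] [FiniteDimensional ℝ K]
    [SecondCountableTopology K] [MeasurableSpace K] [BorelSpace K] (h : IsRealPart re)
    (hd : 1 ≤ d) {q : ℝ} (hq : q ∈ Set.Icc (1 : ℝ) 2) (μ : Measure (Fin d → K))
    (hμ : IsIsotropicMeasure μ) :
    Integrable (momentKernel q) (μ.prod μ) ∧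
      ∫ p, momentKernel q p ∂(μ.prod μ) ≤ momentBound K d q ∧
      (q < 2 → ∫ p, momentKernel q p ∂(μ.prod μ) = momentBound K d q →
        ∃ x : Fin (maxSimplexSize K d) → Fin d → K,
          IsMaximalSimplex x ∧ IsUniformOverPoints μ x) := by
  obtain ⟨V, _, _, _, e, X, hee, heX, hXn, hXX, hXeq, hrank, hv⟩ := h.exists_hermitian_space d
  have := hμ.isProbabilityMeasure
  have : CompleteSpace K := FiniteDimensional.complete ℝ K
  let _ : MeasurableSpace V := borel V
  have : BorelSpace V := ⟨rfl⟩
  have hD : (1 : ℝ) ≤ d := by exact_mod_cast hd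
  have hD0 : (d : ℝ) ≠ 0 := by linarith
  have hm : (1 : ℝ) ≤ Module.finrank ℝ K := by
    exact_mod_cast Module.finrank_pos (R := ℝ) (M := K)
  obtain ⟨g, hgdef⟩ : ∃ g, g = 2 * (Module.finrank ℝ K : ℝ)⁻¹ := ⟨_, rfl⟩
  have hg : 0 < g := by rw [hgdef]; positivity
  have hg2 : g ≤ 2 := by
    rw [hgdef]; have := inv_le_one_of_one_le₀ hm; linarith
  obtain ⟨b, hb⟩ : ∃ b, b = 1 / ((d : ℝ) + g) := ⟨_, rfl⟩
  have hb0 : 0 < b := by rw [hb]; positivity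
  have hb1 : b < 1 := by rw [hb, div_lt_one (by positivity)]; linarith
  have hM : (maxSimplexSize K d : ℝ) = d + ((d : ℝ) ^ 2 - d) / g := by
    rw [hgdef]; exact maxSimplexSize_cast d
  obtain ⟨M, hMdef⟩ : ∃ M, M = maxSimplexSize K d := ⟨_, rfl⟩
  have hM1 : (M : ℝ) - 1 = (d - 1) * (d + g) / g := by
    rw [hMdef, hM]; field_simp; ring
  have hMpos : 0 < M := hMdef ▸ Nat.lt_of_lt_of_le hd (Nat.le_add_right _ _)
  have hp : 1 / 2 ≤ q / 2 := by linarith [hq.1]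
  have hp1 : q / 2 ≤ 1 := by linarith [hq.2]
  obtain ⟨α, γ, C, hα, hγ, hC, hα0, hbound, hmaj⟩ :=
    exists_moment_certificate hp hp1 hD hg hg2 hb hM rfl
  have hc : g * (d - 1) * b / (d : ℝ) ^ 2 = (1 - 1 / d) ^ 2 / ((M : ℝ) - 1) := by
    rw [hM1, hb]
    rcases hD.eq_or_lt with h1 | h1
    · rw [← h1]; simp
    · have : (d : ℝ) - 1 ≠ 0 := by linarith
      have : (d : ℝ) + g ≠ 0 := by linarith
      field_simp
  rw [hc] at hmaj
  have hcont : ∀ v, Continuous fun x => inner ℝ v (X x) := by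
    intro v
    obtain ⟨a, ha, -⟩ := hv v
    simp_rw [ha]
    have := re.continuous_of_finiteDimensional
    fun_prop
  have hX : Measurable X := by
    have : X = fun x => ∑ i, inner ℝ (stdOrthonormalBasis ℝ V i) (X x) •
        stdOrthonormalBasis ℝ V i := by
      funext x
      exact ((stdOrthonormalBasis ℝ V).sum_repr' (X x)).symm
    rw [this]
    have : Continuous fun x => ∑ i, inner ℝ (stdOrthonormalBasis ℝ V i) (X x) •
        stdOrthonormalBasis ℝ V i :=
      continuous_finsetSum _ fun i _ => (hcont _).smul continuous_const
    exact this.measurable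
  -- Isotropy is entrywise; it passes to every real linear functional of the entries of `x x*`,
  -- hence to every `inner ℝ v (X x)`.
  have hlin : ∀ (a : K) (i j : Fin d),
      Integrable (fun x : Fin d → K => re (a * (x i * star (x j)))) μ ∧
      ∫ x : Fin d → K, re (a * (x i * star (x j))) ∂μ =
        re (a * ((1 / (d : ℝ)) • (1 : Matrix (Fin d) (Fin d) K)) i j) := by
    intro a i j
    let L : K →L[ℝ] ℝ :=
      (LinearMap.toContinuousLinearMap re).comp (ContinuousLinearMap.mul ℝ K a)
    refine ⟨L.integrable_comp (hμ.integrable i j), ?_⟩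
    have := L.integral_comp_comm (hμ.integrable i j)
    rw [hμ.integral_eq] at this
    exact this
  have hvi : ∀ v, Integrable (fun x => inner ℝ v (X x)) μ := by
    intro v
    obtain ⟨a, ha, -⟩ := hv v
    simp_rw [ha]
    exact integrable_finsetSum _ fun i _ => integrable_finsetSum _ fun j _ => (hlin _ i j).1
  have hE : ∀ v, ∫ x, inner ℝ v (X x) ∂μ = inner ℝ v e / (d : ℝ) := by
    intro v
    obtain ⟨a, ha, hae⟩ := hv v
    simp_rw [ha]
    rw [integral_finsetSum _ fun i _ => integrable_finsetSum _ fun j _ => (hlin _ i j).1, hae,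
      Finset.sum_div]
    refine Finset.sum_congr rfl fun i _ => ?_
    rw [integral_finsetSum _ fun j _ => (hlin _ i j).1, Finset.sum_eq_single i]
    · rw [(hlin _ i i).2]
      simp [div_eq_inv_mul]
    · intro j _ hj
      rw [(hlin _ i j).2]
      simp [Matrix.one_apply_ne' hj]
    · simp
  have hXi : Integrable (fun x => ‖X x‖) μ := by
    simp_rw [← heX]; exact hvi e
  obtain ⟨hint, hle, heq⟩ := moment_le_of_certificate (μ := μ) hD hp hp1 hα hγ hC
    (fun s hs => (hmaj s hs).1) hX (fun x y => by rw [hXX]; positivity) hee heX hXi hE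
    (M := M) (by rw [hMdef]; exact_mod_cast hrank) rfl
  have hker : momentKernel q = fun z : (Fin d → K) × (Fin d → K) =>
      (inner ℝ (X z.1) (X z.2) : ℝ) ^ (q / 2) := by
    funext z
    rw [hXX, momentKernel, ← Real.rpow_natCast, ← Real.rpow_mul (norm_nonneg _)]
    congr 1; push_cast; ring
  have hβ : momentBound K d q = α + γ / d := by
    rw [hbound, momentBound, simplexBeta, ← hgdef, ← hb, Real.sqrt_eq_rpow,
      ← Real.rpow_mul hb0.le, one_div_mul_eq_div]
  rw [hker, hβ]
  refine ⟨hint, hle, fun hq2 hEq => ?_⟩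
  have hp2 : q / 2 < 1 := by linarith
  obtain ⟨hone, hae⟩ := heq (hα0 hp2) hp2 hEq
  have hpairs : ∀ᵐ z ∂(μ.prod μ), inner ℝ (X z.1) (X z.2) = b ∨
      inner ℝ (X z.1) (X z.2) = (1 : ℝ) := by
    filter_upwards [hae, Measure.quasiMeasurePreserving_fst.ae hone,
      Measure.quasiMeasurePreserving_snd.ae hone] with z hz h1 h2
    refine (hmaj _ ⟨by rw [hXX]; positivity, ?_⟩).2 hp2 hz
    simpa [h1, h2] using real_inner_le_norm (X z.1) (X z.2)
  subst hMdef
  obtain ⟨v, hvij, hvn, hvm, hvae⟩ := exists_uniform_of_ae_inner_eq hX heX hE hone hpairs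
    hb1 hMpos (by
      have h3 : (maxSimplexSize K d : ℝ) * g = d * (d + g - 1) := by
        rw [hM]; field_simp; ring
      have hM0 : (maxSimplexSize K d : ℝ) ≠ 0 := by exact_mod_cast hMpos.ne'
      have : (d : ℝ) + g ≠ 0 := by linarith
      rw [hb]
      field_simp
      linear_combination -h3)
  -- An atom of positive mass is a value of `X`, hence of the form `x x*`.
  have hrange : ∀ i, ∃ x, X x = v i := fun i => by
    have : μ (X ⁻¹' {v i}) ≠ 0 := by
      rw [hvm]; exact ENNReal.inv_ne_zero.2 (ENNReal.natCast_ne_top _)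
    exact nonempty_of_measure_ne_zero this
  choose x hx using hrange
  have hx1 : ∀ i, ∑ k, ‖x i k‖ ^ 2 = 1 := fun i => by rw [← hXn, hx, hvn]
  have hmem : ∀ i y, y ∈ unitRepresentatives (x i) ↔ X y = v i := by
    intro i y
    rw [← hx i]
    constructor
    · intro hy
      rw [hXeq]
      refine (h.mem_unitRepresentatives_iff (hx1 i) ?_).1 hy
      obtain ⟨c, hc, hyc⟩ := hy
      simp [hyc, hc]
    · intro hy
      exact (h.mem_unitRepresentatives_iff (hx1 i) (by rw [← hXn, ← hXn, hy])).2
        ((hXeq _ _).1 hy)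
  refine ⟨x, h.isRegularSimplex_of_norm_sq hb1 hx1 fun i j hij => ?_, ?_, fun i => ?_⟩
  · rw [← hXX, hx, hx, hvij i j hij]
  · simpa only [hmem] using hvae
  · rw [← hvm i]
    congr 1
    ext y
    exact hmem i y

end IsRealPart

end

theorem mainTheorem1 (d : ℕ) (hd : 1 ≤ d) (q : ℝ) (hq : q ∈ Set.Icc (1 : ℝ) 2) :
    (∀ μ : Measure (Fin d → ℝ), IsIsotropicMeasure μ →
      Integrable (momentKernel q) (μ.prod μ) ∧
      ∫ p, momentKernel q p ∂(μ.prod μ) ≤ momentBound ℝ d q ∧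
      (q < 2 → ∫ p, momentKernel q p ∂(μ.prod μ) = momentBound ℝ d q →
        ∃ x : Fin (maxSimplexSize ℝ d) → Fin d → ℝ,
          IsMaximalSimplex x ∧ IsUniformOverPoints μ x)) ∧
    (∀ μ : Measure (Fin d → ℂ), IsIsotropicMeasure μ →
      Integrable (momentKernel q) (μ.prod μ) ∧
      ∫ p, momentKernel q p ∂(μ.prod μ) ≤ momentBound ℂ d q ∧
      (q < 2 → ∫ p, momentKernel q p ∂(μ.prod μ) = momentBound ℂ d q →
        ∃ x : Fin (maxSimplexSize ℂ d) → Fin d → ℂ,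
          IsMaximalSimplex x ∧ IsUniformOverPoints μ x)) ∧
    (∀ μ : Measure (Fin d → ℍ[ℝ]), IsIsotropicMeasure μ →
      Integrable (momentKernel q) (μ.prod μ) ∧
      ∫ p, momentKernel q p ∂(μ.prod μ) ≤ momentBound ℍ[ℝ] d q ∧
      (q < 2 → ∫ p, momentKernel q p ∂(μ.prod μ) = momentBound ℍ[ℝ] d q →
        ∃ x : Fin (maxSimplexSize ℍ[ℝ] d) → Fin d → ℍ[ℝ],
          IsMaximalSimplex x ∧ IsUniformOverPoints μ x)) := by

  exact ⟨isRealPart_real.moment_bound hd hq, isRealPart_complex.moment_bound hd hq,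
    isRealPart_quaternion.moment_bound hd hq⟩
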